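/- Let $\mathcal P(\mu,\lambda)=\mu R+\lambda S$ with $R,S\in\mathbb C^{m\times n}$ be a complex $m\times n$ matrix pencil. Two $m\times n$ pencils $\mathcal P,\mathcal P'$ are \emph{strictly equivalent} if there are $B\in GL_m(\mathbb C)$, $C\in GL_n(\mathbb C)$ with $B\,\mathcal P(\mu,\lambda)\,C^T=\mathcal P'(\mu,\lambda)$ for all $\mu,\lambda$. Let $D_m\in\mathbb C[\mu,\lambda]$ be the greatest common divisor of all $m$-minors of $\mathcal P$ (determined up to a nonzero constant factor; the empty minor is $1$, so $D_0=1$, and $D_m=0$ if all $m$-minors vanish). For an integer $\epsilon\ge 0$ let $L_\epsilon$ be the $\epsilon\times(\epsilon+1)$ pencil with entries $\lambda$ at the positions $(i,i)$, $\mu$ at the positions $(i,i+1)$, and $0$ elsewhere (so $L_0$ is a $0\times 1$ block and contributes a zero column to a direct sum). Lemma. Let $\mathcal P$ be an $m\times n$ matrix pencil with $n>m$. Then $D_m=1$ if and only if $\mathcal P$ is strictly equivalent to a direct sum $L_{\epsilon_1}\oplus\dots\oplus L_{\epsilon_a}$ of right null-space blocks with $\epsilon_i\ge 0$. If moreover there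 is no nonzero vector $v\in\mathbb C^n$ with $Rv=Sv=0$, then $D_m=1$ if and only if $\mathcal P$ is strictly equivalent to such a direct sum with all $\epsilon_i\ge 1$. In particular, an $m\times(m+1)$ pencil has $D_m=1$ if and only if it is strictly equivalent to $L_m$. -/

import Mathlib

/-- A complex `m × n` linear matrix pencil `μ R + λ S`, given by its two coefficient matrices. -/
@[ext]
structure MatrixPencil (m n : ℕ) where
  R : Matrix (Fin m) (Fin n) ℂ
  S : Matrix (Fin m) (Fin n) ℂ

namespace MatrixPencil

/-- The value `μ R + λ S` of the pencil at complex numbers `μ` and `l` (for `λ`). -/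
def eval {m n : ℕ} (P : MatrixPencil m n) (μ l : ℂ) : Matrix (Fin m) (Fin n) ℂ :=
  μ • P.R + l • P.S

/-- The pencil as a matrix over the polynomial ring `ℂ[μ, λ]`; here `X 0` is `μ`, `X 1` is `λ`. -/
noncomputable def toMatrix {m n : ℕ} (P : MatrixPencil m n) :
    Matrix (Fin m) (Fin n) (MvPolynomial (Fin 2) ℂ) :=
  (MvPolynomial.X 0 : MvPolynomial (Fin 2) ℂ) • P.R.map MvPolynomial.C +
    (MvPolynomial.X 1 : MvPolynomial (Fin 2) ℂ) • P.S.map MvPolynomial.C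

/-- Two pencils of the same size are strictly equivalent if `B (μ R + λ S) Cᵀ = μ R' + λ S'`
for all `μ`, `λ`, with constant invertible matrices `B` and `C`. -/
def StrictlyEquivalent {m n : ℕ} (P Q : MatrixPencil m n) : Prop :=
  ∃ (B : Matrix.GeneralLinearGroup (Fin m) ℂ) (C : Matrix.GeneralLinearGroup (Fin n) ℂ),
    ∀ μ l : ℂ, B.val * P.eval μ l * C.val.transpose = Q.eval μ l

/-- The `k`-minor of the pencil on the rows `r` and the columns `c`, a polynomial in `μ`, `λ`. -/
noncomputable def minor {m n : ℕ} (P : MatrixPencil m n) (k : ℕ)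
    (r : Fin k ↪o Fin m) (c : Fin k ↪o Fin n) : MvPolynomial (Fin 2) ℂ :=
  (P.toMatrix.submatrix r c).det

/-- `P.IsMinorGcd k d`: the polynomial `d` is a greatest common divisor in `ℂ[μ, λ]` of all
`k`-minors of `P`, that is `D_k = d`. As every polynomial gcd, `D_k` is determined up to a nonzero
constant factor; `D_k = 1` is `P.IsMinorGcd k 1`. -/
def IsMinorGcd {m n : ℕ} (P : MatrixPencil m n) (k : ℕ) (d : MvPolynomial (Fin 2) ℂ) : Prop :=
  (∀ r c, d ∣ P.minor k r c) ∧
    ∀ e : MvPolynomial (Fin 2) ℂ, (∀ r c, e ∣ P.minor k r c) → e ∣ d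

/-- The right null-space block `L_ε`, of size `ε × (ε + 1)`: entries `λ` on the diagonal, entries
`μ` directly to the right of the diagonal, all others zero. `L_0` is a `0 × 1` block. -/
def LBlock (ε : ℕ) : MatrixPencil ε (ε + 1) where
  R := Matrix.of fun i j => if j = i.succ then 1 else 0
  S := Matrix.of fun i j => if j = i.castSucc then 1 else 0

/-- The direct sum of finitely many (rectangular) pencils: the blocks are placed along the
diagonal, in the given order. -/
def directSum {a : ℕ} {p q : Fin a → ℕ} (P : ∀ i, MatrixPencil (p i) (q i)) :
    MatrixPencil (∑ i, p i) (∑ i, q i) where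
  R := (Matrix.blockDiagonal' fun i => (P i).R).reindex finSigmaFinEquiv finSigmaFinEquiv
  S := (Matrix.blockDiagonal' fun i => (P i).S).reindex finSigmaFinEquiv finSigmaFinEquiv

/-- The same pencil, its size rewritten along equalities of natural numbers. -/
def cast {m n m' n' : ℕ} (hm : m = m') (hn : n = n') (P : MatrixPencil m n) :
    MatrixPencil m' n' where
  R := P.R.reindex (finCongr hm) (finCongr hn)
  S := P.S.reindex (finCongr hm) (finCongr hn)

/-- `P` is strictly equivalent to the direct sum of the blocks `L_{ε_1}, …, L_{ε_a}`
(in particular the sizes match). -/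
def EquivalentToLSum {m n a : ℕ} (P : MatrixPencil m n) (ε : Fin a → ℕ) : Prop :=
  ∃ (hm : ∑ i, ε i = m) (hn : ∑ i, (ε i + 1) = n),
    P.StrictlyEquivalent (cast hm hn (directSum fun i => LBlock (ε i)))

/-- No nonzero constant vector is annihilated by both `R` and `S`. -/
def NoConstantRightNullVector {m n : ℕ} (P : MatrixPencil m n) : Prop :=
  ∀ v : Fin n → ℂ, P.R.mulVec v = 0 → P.S.mulVec v = 0 → v = 0

end MatrixPencil

/-! If all maximal minors vanish at `(a, b) ≠ 0`, the form `aλ - bμ` divides each of them; so `D_m =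
1` makes every nonzero value of the pencil surjective (`IsMinorGcd.surjective`). For such a pair `A,
B : V → W`, induct on `dim W` (`exists_of_surjective`). Put `K = ker B` and identify `W` with `V /
K`; the pair induces another one `W → W / A(K)` with the same property. An eigenvalue argument gives
`A(K) ≠ 0`, so the target shrinks. Each chain of the smaller pair lifts to `V` and gains one vector
from `K`, and `ker A ∩ ker B` supplies the blocks `L_0` (`exists_of_quotient`). Conversely, a direct
sum of blocks has the coprime maximal minors `μ ^ m` and `λ ^ m`, and common divisors of maximal
minors survive strict equivalence (`dvd_det_mul`). -/

/-- Bases of `V` and `W` in which the pair `A, B : V → W` is a direct sum of right null-space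
blocks of sizes `ε i`, with `A` the coefficient of `μ` and `B` the coefficient of `λ`. -/
structure NullSpaceBlockBases {V W : Type*} [AddCommGroup V] [Module ℂ V] [AddCommGroup W]
    [Module ℂ W] (A B : V →ₗ[ℂ] W) {ι : Type} (ε : ι → ℕ) where
  src : Module.Basis (Σ i, Fin (ε i + 1)) ℂ V
  tgt : Module.Basis (Σ i, Fin (ε i)) ℂ W
  fst_zero : ∀ i, A (src ⟨i, 0⟩) = 0
  fst_succ : ∀ i (j : Fin (ε i)), A (src ⟨i, j.succ⟩) = tgt ⟨i, j⟩
  snd_castSucc : ∀ i (j : Fin (ε i)), B (src ⟨i, j.castSucc⟩) = tgt ⟨i, j⟩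
  snd_last : ∀ i, B (src ⟨i, Fin.last _⟩) = 0

/-! ### Block bases for pairs of linear maps. -/

namespace NullSpaceBlockBases

variable {V W : Type*} [AddCommGroup V] [Module ℂ V] [AddCommGroup W] [Module ℂ W]
  {A B : V →ₗ[ℂ] W}

/-- Reindexing the blocks. -/
noncomputable def reindex {ι κ : Type} {ε : ι → ℕ} (b : NullSpaceBlockBases A B ε) (e : κ ≃ ι) :
    NullSpaceBlockBases A B (ε ∘ e) where
  src := b.src.reindex (Equiv.sigmaCongrLeft (β := fun i => Fin (ε i + 1)) e).symm
  tgt := b.tgt.reindex (Equiv.sigmaCongrLeft (β := fun i => Fin (ε i)) e).symm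
  fst_zero i := by
    rw [Module.Basis.reindex_apply]; exact b.fst_zero (e i)
  fst_succ i j := by
    rw [Module.Basis.reindex_apply, Module.Basis.reindex_apply]; exact b.fst_succ (e i) j
  snd_castSucc i j := by
    rw [Module.Basis.reindex_apply, Module.Basis.reindex_apply]; exact b.snd_castSucc (e i) j
  snd_last i := by
    rw [Module.Basis.reindex_apply]; exact b.snd_last (e i)

/-- A pair of maps to the zero space is a sum of blocks `L_0`. -/
theorem exists_of_subsingleton [FiniteDimensional ℂ V] [Subsingleton W] (A B : V →ₗ[ℂ] W) :
    ∃ (ι : Type) (_ : Fintype ι) (ε : ι → ℕ), Nonempty (NullSpaceBlockBases A B ε) :=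
  ⟨Fin (Module.finrank ℂ V), inferInstance, fun _ => 0, ⟨{
    src := (Module.finBasis ℂ V).reindex (Equiv.sigmaUnique _ fun _ => Fin 1).symm
    tgt := @Module.Basis.empty _ _ W _ _ _ _ ⟨fun p => p.2.elim0⟩
    fst_zero := fun _ => Subsingleton.elim _ _
    fst_succ := fun _ _ => Subsingleton.elim _ _
    snd_castSucc := fun _ _ => Subsingleton.elim _ _
    snd_last := fun _ => Subsingleton.elim _ _ }⟩⟩

/-- If all nontrivial combinations of `A` and `B` are surjective onto a nonzero space, then `A`
does not vanish on the kernel of `B`. -/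
theorem map_ker_ne_bot [FiniteDimensional ℂ W] [Nontrivial W]
    (h : ∀ a b : ℂ, (a, b) ≠ 0 → Function.Surjective (a • A + b • B)) :
    (LinearMap.ker B).map A ≠ ⊥ := by
  intro hK
  have hK' : ∀ k, B k = 0 → A k = 0 := fun k hk => by
    have : A k ∈ (LinearMap.ker B).map A := ⟨k, hk, rfl⟩
    rwa [hK, Submodule.mem_bot] at this
  have hB : Function.Surjective B := by simpa using h 0 1 (by simp)
  obtain ⟨s, hs⟩ := B.exists_rightInverse_of_surjective (LinearMap.range_eq_top.2 hB)
  have hs' : ∀ w, B (s w) = w := fun w => LinearMap.congr_fun hs w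
  -- As `A` kills `ker B`, `A = (A ∘ s) ∘ B`. Surjectivity of `A - tB` then forces `A ∘ s - t` to be
  -- bijective, even at an eigenvalue `t`.
  obtain ⟨t, ht⟩ := Module.End.exists_eigenvalue (K := ℂ) (V := W) (A ∘ₗ s)
  obtain ⟨w, hw⟩ := ht.exists_hasEigenvector
  have hsurj : Function.Surjective (A ∘ₗ s - t • (LinearMap.id : W →ₗ[ℂ] W)) := by
    intro y
    obtain ⟨v, hv⟩ := h 1 (-t) (by simp) y
    refine ⟨B v, ?_⟩
    have h1 : A (v - s (B v)) = 0 := hK' _ (by simp [hs'])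
    rw [map_sub, sub_eq_zero] at h1
    rw [← hv]
    simp [← h1, sub_eq_add_neg]
  have hinj := LinearMap.injective_iff_surjective.2 hsurj
  refine hw.2 (hinj ?_)
  have := hw.apply_eq_smul
  rw [map_zero, LinearMap.sub_apply, this]
  simp

/-- Blocks of the pair induced by `A` and `B` on `W → W / A (ker B)`, where `W` is identified with
`V / ker B`, lift to blocks of one size more. -/
theorem exists_of_quotient [FiniteDimensional ℂ V] [FiniteDimensional ℂ W] {s : W →ₗ[ℂ] V}
    (hs : ∀ w, B (s w) = w) {ι : Type} [Fintype ι] {ε : ι → ℕ}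
    (b : NullSpaceBlockBases (((LinearMap.ker B).map A).mkQ ∘ₗ A ∘ₗ s)
      ((LinearMap.ker B).map A).mkQ ε) :
    ∃ (κ : Type) (_ : Fintype κ) (δ : κ → ℕ), Nonempty (NullSpaceBlockBases A B δ) := by
  classical
  set K := LinearMap.ker B with hK
  -- An equality modulo `A(K)` becomes exact after a correction by a vector of `K`, which `B` does
  -- not see.
  have lift : ∀ v w, (K.map A).mkQ (A v) = (K.map A).mkQ w → ∃ k ∈ K, A (v + k) = w := by
    intro v w h
    rw [← sub_eq_zero, ← map_sub, Submodule.mkQ_apply, Submodule.Quotient.mk_eq_zero] at h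
    obtain ⟨k, hk, hk'⟩ := h
    exact ⟨-k, neg_mem hk, by rw [map_add, map_neg, hk']; abel⟩
  have h0 : ∀ i, ∃ k ∈ K, A (s (b.src ⟨i, 0⟩) + k) = 0 := fun i =>
    lift _ _ (by rw [map_zero]; exact b.fst_zero i)
  have h1 : ∀ i (j : Fin (ε i)), ∃ k ∈ K,
      A (s (b.src ⟨i, j.succ⟩) + k) = b.src ⟨i, j.castSucc⟩ := fun i j =>
    lift _ _ ((b.fst_succ i j).trans (b.snd_castSucc i j).symm)
  have h2 : ∀ i, ∃ k ∈ K, A k = b.src ⟨i, Fin.last _⟩ := fun i => by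
    simpa using lift 0 (b.src ⟨i, Fin.last _⟩) (by rw [map_zero, map_zero]; exact (b.snd_last i).symm)
  choose k0 k0K hk0 using h0
  choose k1 k1K hk1 using h1
  choose k2 k2K hk2 using h2
  let N := LinearMap.ker (A ∘ₗ K.subtype)
  let bN := Module.finBasis ℂ N
  let κ := Fin (Module.finrank ℂ N)
  let δ : ι ⊕ κ → ℕ := Sum.elim (fun i => ε i + 1) (fun _ => 0)
  let u : ∀ i, Fin (ε i + 1) → V := fun i =>
    Fin.cons (s (b.src ⟨i, 0⟩) + k0 i) (fun j => s (b.src ⟨i, j.succ⟩) + k1 i j)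
  have Bu : ∀ i j, B (u i j) = b.src ⟨i, j⟩ := by
    intro i j
    refine Fin.cases ?_ (fun j => ?_) j
    · have : B (k0 i) = 0 := k0K i
      simp [u, hs, this]
    · have : B (k1 i j) = 0 := k1K i j
      simp [u, hs, this]
  -- A lifted chain is closed by `k2 i ∈ K`, which `A` sends to the last vector of the old chain; a
  -- basis of `ker A ∩ ker B` gives the blocks `L_0`.
  let v : ∀ x : ι ⊕ κ, Fin (δ x + 1) → V := fun x => match x with
    | Sum.inl i => Fin.snoc (α := fun _ => V) (u i) (k2 i)
    | Sum.inr k => fun _ => ((bN k : K) : V)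
  have BN : ∀ k, B ((bN k : K) : V) = 0 := fun k => (bN k : K).2
  have AN : ∀ k, A ((bN k : K) : V) = 0 := fun k => (bN k).2
  let w : ∀ x : ι ⊕ κ, Fin (δ x) → W := fun x => match x with
    | Sum.inl i => fun j => b.src ⟨i, j⟩
    | Sum.inr _ => fun j => j.elim0
  have vz : ∀ x, A (v x 0) = 0 := by
    rintro (i | k)
    · exact hk0 i
    · exact AN k
  have vs : ∀ x (j : Fin (δ x)), A (v x j.succ) = w x j := by
    rintro (i | k) j
    · change Fin (ε i + 1) at j
      change A (Fin.snoc (α := fun _ => V) (u i) (k2 i) j.succ) = b.src ⟨i, j⟩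
      refine Fin.lastCases ?_ (fun j => ?_) j
      · rw [Fin.succ_last, Fin.snoc_last, hk2]
      · rw [Fin.succ_castSucc, Fin.snoc_castSucc]
        simp [u, hk1]
    · exact j.elim0
  have vc : ∀ x (j : Fin (δ x)), B (v x j.castSucc) = w x j := by
    rintro (i | k) j
    · change Fin (ε i + 1) at j
      change B (Fin.snoc (α := fun _ => V) (u i) (k2 i) j.castSucc) = b.src ⟨i, j⟩
      rw [Fin.snoc_castSucc, Bu]
    · exact j.elim0
  have vl : ∀ x, B (v x (Fin.last _)) = 0 := by
    rintro (i | k)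
    · change B (Fin.snoc (α := fun _ => V) (u i) (k2 i) (Fin.last (ε i + 1))) = 0
      rw [Fin.snoc_last]
      exact k2K i
    · exact BN k
  have li : LinearIndependent ℂ (fun p : Σ x, Fin (δ x + 1) => v p.1 p.2) := by
    rw [Fintype.linearIndependent_iff]
    intro g hg
    rw [Fintype.sum_sigma, Fintype.sum_sum_type] at hg
    have hsum : ∀ i : ι, ∑ j, g ⟨Sum.inl i, j⟩ • v (Sum.inl i) j =
        ∑ j : Fin (ε i + 1), g ⟨Sum.inl i, j.castSucc⟩ • u i j
          + g ⟨Sum.inl i, Fin.last (ε i + 1)⟩ • k2 i := fun i => by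
      refine (Fin.sum_univ_castSucc (n := ε i + 1)
        (fun j => g ⟨Sum.inl i, j⟩ • Fin.snoc (α := fun _ => V) (u i) (k2 i) j)).trans ?_
      simp only [Fin.snoc_castSucc, Fin.snoc_last]
    have hsumN : ∀ k : κ, ∑ j, g ⟨Sum.inr k, j⟩ • v (Sum.inr k) j =
        g ⟨Sum.inr k, 0⟩ • ((bN k : K) : V) := fun k =>
      Fin.sum_univ_one (fun j : Fin 1 => g ⟨Sum.inr k, j⟩ • ((bN k : K) : V))
    simp only [hsum, hsumN] at hg
    -- Applying `B` isolates the coefficients of the `u i j`, then `A` those of the `k2 i`; only the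
    -- basis of `N` remains.
    have bli := Fintype.linearIndependent_iff.1 b.src.linearIndependent
    have k2B : ∀ i, B (k2 i) = 0 := k2K
    have g1 : ∀ i (j : Fin (ε i + 1)), g ⟨Sum.inl i, j.castSucc⟩ = 0 := fun i j => by
      refine bli (fun p => g ⟨Sum.inl p.1, p.2.castSucc⟩) ?_ ⟨i, j⟩
      have := congrArg B hg
      simp only [map_add, map_sum, map_smul, Bu, k2B, BN, smul_zero, add_zero,
        Finset.sum_const_zero, map_zero] at this
      rwa [Fintype.sum_sigma]
    simp only [g1, zero_smul, Finset.sum_const_zero, zero_add] at hg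
    have g2 : ∀ i, g ⟨Sum.inl i, Fin.last (ε i + 1)⟩ = 0 := fun i => by
      have inj : Function.Injective (fun i => (⟨i, Fin.last _⟩ : Σ i, Fin (ε i + 1))) :=
        fun i j h => (Sigma.mk.inj h).1
      refine Fintype.linearIndependent_iff.1 (b.src.linearIndependent.comp _ inj)
        (fun i => g ⟨Sum.inl i, Fin.last (ε i + 1)⟩) ?_ i
      have := congrArg A hg
      simp only [map_add, map_sum, map_smul, hk2, AN, smul_zero, add_zero,
        Finset.sum_const_zero, map_zero] at this
      exact this
    simp only [g2, zero_smul, Finset.sum_const_zero, zero_add] at hg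
    have g3 : ∀ k, g ⟨Sum.inr k, 0⟩ = 0 := by
      refine Fintype.linearIndependent_iff.1 bN.linearIndependent _ ?_
      ext
      simpa using hg
    rintro ⟨i | k, j⟩
    · change Fin (ε i + 1 + 1) at j
      exact Fin.lastCases (g2 i) (fun j => g1 i j) j
    · change Fin 1 at j
      rw [Subsingleton.elim j 0]
      exact g3 k
  -- Rank-nullity for `B` and for `A` on `K`; `dim A(K)` is the number of old chains, since `dim W`
  -- and `dim W / A(K)` differ by one per chain.
  have card : Fintype.card (Σ x, Fin (δ x + 1)) = Module.finrank ℂ V := by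
    have e1 := B.finrank_range_add_finrank_ker
    rw [LinearMap.range_eq_top.2 (fun w => ⟨s w, hs w⟩), finrank_top, ← hK] at e1
    have e2 := (A ∘ₗ K.subtype).finrank_range_add_finrank_ker
    rw [LinearMap.range_comp, Submodule.range_subtype] at e2
    have e3 := Submodule.finrank_quotient_add_finrank (K.map A)
    have e4 := Module.finrank_eq_card_basis b.src
    have e5 := Module.finrank_eq_card_basis b.tgt
    simp only [Fintype.card_sigma, Fintype.card_fin, Finset.sum_add_distrib] at e4 e5
    simp only [Fintype.card_sigma, Fintype.card_fin, Fintype.sum_sum_type, δ, Sum.elim_inl,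
      Sum.elim_inr, Finset.sum_add_distrib, κ, N]
    simp only [Finset.sum_const, Finset.card_univ, Fintype.card_fin, smul_eq_mul, mul_one,
      mul_zero] at *
    omega
  let eW : (Σ i, Fin (ε i + 1)) ≃ Σ x, Fin (δ x) :=
    { toFun := fun p => ⟨Sum.inl p.1, p.2⟩
      invFun := fun p => match p with
        | ⟨Sum.inl i, j⟩ => ⟨i, j⟩
        | ⟨Sum.inr _, j⟩ => j.elim0
      left_inv := fun _ => rfl
      right_inv := by
        rintro ⟨i | k, j⟩
        · rfl
        · exact j.elim0 }
  have hw : ∀ x (j : Fin (δ x)), b.src.reindex eW ⟨x, j⟩ = w x j := by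
    rintro (i | k) j
    · rw [Module.Basis.reindex_apply]; rfl
    · exact j.elim0
  let bV := Module.Basis.mk li (li.span_eq_top_of_card_eq_finrank' card).ge
  have hv : ∀ x j, bV ⟨x, j⟩ = v x j := fun x j => by simp [bV]
  exact ⟨ι ⊕ κ, inferInstance, δ, ⟨{
    src := bV
    tgt := b.src.reindex eW
    fst_zero := fun x => by rw [hv, vz]
    fst_succ := fun x j => by rw [hv, hw, vs]
    snd_castSucc := fun x j => by rw [hv, hw, vc]
    snd_last := fun x => by rw [hv, vl] }⟩⟩

/-- If all nontrivial combinations of `A` and `B` are surjective, then the pair is a direct sum of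
right null-space blocks. -/
theorem exists_of_surjective {V W : Type} [AddCommGroup V] [Module ℂ V] [AddCommGroup W]
    [Module ℂ W] [FiniteDimensional ℂ V] [FiniteDimensional ℂ W] (A B : V →ₗ[ℂ] W)
    (h : ∀ a b : ℂ, (a, b) ≠ 0 → Function.Surjective (a • A + b • B)) :
    ∃ (ι : Type) (_ : Fintype ι) (ε : ι → ℕ), Nonempty (NullSpaceBlockBases A B ε) := by
  induction hd : Module.finrank ℂ W using Nat.strong_induction_on generalizing V W with
  | _ d ih =>
  rcases subsingleton_or_nontrivial W with _ | _
  · exact exists_of_subsingleton A B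
  have hB : Function.Surjective B := by simpa using h 0 1 (by simp)
  obtain ⟨s, hs⟩ := B.exists_rightInverse_of_surjective (LinearMap.range_eq_top.2 hB)
  have hs' : ∀ w, B (s w) = w := fun w => LinearMap.congr_fun hs w
  have hlt : Module.finrank ℂ (W ⧸ (LinearMap.ker B).map A) < d := by
    have e3 := Submodule.finrank_quotient_add_finrank ((LinearMap.ker B).map A)
    have : Module.finrank ℂ ((LinearMap.ker B).map A) ≠ 0 := fun h0 =>
      map_ker_ne_bot h (Submodule.finrank_eq_zero.1 h0)
    omega
  -- Composing a combination of the induced pair with `B` gives the same combination of `A, B`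
  -- modulo `A(K)`, so surjectivity is inherited.
  obtain ⟨ι, _, ε, ⟨b⟩⟩ := ih _ hlt (((LinearMap.ker B).map A).mkQ ∘ₗ A ∘ₗ s)
    ((LinearMap.ker B).map A).mkQ (by
      intro a b hab y
      obtain ⟨y, rfl⟩ := Submodule.mkQ_surjective _ y
      obtain ⟨v, rfl⟩ := h a b hab y
      refine ⟨B v, ?_⟩
      have hk : ((LinearMap.ker B).map A).mkQ (A (v - s (B v))) = 0 := by
        rw [Submodule.mkQ_apply, Submodule.Quotient.mk_eq_zero]
        exact ⟨_, by simp [hs'], rfl⟩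
      rw [map_sub, map_sub, sub_eq_zero] at hk
      simp only [LinearMap.add_apply, LinearMap.smul_apply, LinearMap.comp_apply, map_add,
        map_smul, hk]) rfl
  exact exists_of_quotient hs' b

end NullSpaceBlockBases

/-! ### Minors and strict equivalence. -/

namespace MatrixPencil

open MvPolynomial
open scoped Matrix

theorem toMatrix_apply {m n : ℕ} (P : MatrixPencil m n) (i : Fin m) (j : Fin n) :
    P.toMatrix i j = X 0 * C (P.R i j) + X 1 * C (P.S i j) := by
  simp [toMatrix]

theorem strictlyEquivalent_iff {m n : ℕ} {P Q : MatrixPencil m n} :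
    P.StrictlyEquivalent Q ↔
      ∃ (B : Matrix.GeneralLinearGroup (Fin m) ℂ) (D : Matrix.GeneralLinearGroup (Fin n) ℂ),
        B.val * P.R * D.val.transpose = Q.R ∧ B.val * P.S * D.val.transpose = Q.S := by
  constructor
  · rintro ⟨B, C, h⟩
    exact ⟨B, C, by simpa [eval] using h 1 0, by simpa [eval] using h 0 1⟩
  · rintro ⟨B, C, h1, h2⟩
    refine ⟨B, C, fun μ l => ?_⟩
    simp only [eval, Matrix.mul_add, Matrix.add_mul, Matrix.mul_smul, Matrix.smul_mul, h1, h2]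

theorem StrictlyEquivalent.exists_toMatrix_eq {m n : ℕ} {P Q : MatrixPencil m n}
    (h : P.StrictlyEquivalent Q) :
    ∃ (B : Matrix (Fin m) (Fin m) (MvPolynomial (Fin 2) ℂ))
      (D : Matrix (Fin n) (Fin n) (MvPolynomial (Fin 2) ℂ)), B * P.toMatrix * D = Q.toMatrix := by
  obtain ⟨B, D, h1, h2⟩ := strictlyEquivalent_iff.1 h
  refine ⟨B.val.map C, D.val.transpose.map C, ?_⟩
  simp only [toMatrix, ← h1, ← h2, Matrix.map_mul, Matrix.mul_add, Matrix.add_mul,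
    Matrix.mul_smul, Matrix.smul_mul]

/-- A common divisor of the maximal minors of a matrix divides the determinant of every product
with it on the left. -/
theorem dvd_det_mul {R : Type*} [CommRing R] {m n : ℕ} (M : Matrix (Fin m) (Fin n) R) {e : R}
    (h : ∀ c : Fin m ↪o Fin n, e ∣ (M.submatrix id c).det) (N : Matrix (Fin n) (Fin m) R) :
    e ∣ (M * N).det := by
  have key : ∀ c : Fin m → Fin n, e ∣ (M.submatrix id c).det := by
    intro c
    by_cases hc : Function.Injective c
    · have hmono : StrictMono (c ∘ Tuple.sort c) :=
        (Tuple.monotone_sort c).strictMono_of_injective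
          (hc.comp (Tuple.sort c).injective)
      have := h (OrderEmbedding.ofStrictMono _ hmono)
      have h2 : M.submatrix id (OrderEmbedding.ofStrictMono _ hmono) =
          (M.submatrix id c).submatrix id (Tuple.sort c) := rfl
      rw [h2, Matrix.det_permute'] at this
      exact (((Equiv.Perm.sign (Tuple.sort c)).isUnit.map (Int.castRingHom R)).dvd_mul_left).1 this
    · rw [Function.Injective] at hc
      push Not at hc
      obtain ⟨i, j, hij, hne⟩ := hc
      rw [Matrix.det_zero_of_column_eq hne (fun k => by simp [hij])]
      exact dvd_zero e
  -- Cauchy–Binet before grouping: the sum runs over all column choices, repeated or unsorted ones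
  -- included.
  have hexp : (M * N).det = ∑ c : Fin m → Fin n, (∏ i, N (c i) i) * (M.submatrix id c).det := by
    rw [← Matrix.det_transpose]
    have : (M * N).transpose = fun i => ∑ k, N k i • M.transpose k := by
      ext i j
      simp [Matrix.mul_apply, Finset.sum_apply, mul_comm]
    rw [this]
    change Matrix.detRowAlternating.toMultilinearMap _ = _
    rw [MultilinearMap.map_sum]
    refine Finset.sum_congr rfl fun c _ => ?_
    rw [MultilinearMap.map_smul_univ, smul_eq_mul, ← Matrix.det_transpose (M.submatrix id c)]
    rfl
  rw [hexp]
  exact Finset.dvd_sum fun c _ => (key c).mul_left _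

/-- The only order embedding of `Fin m` into itself is the identity, so the choice of rows
disappears. -/
theorem isMinorGcd_one_iff {m n : ℕ} {P : MatrixPencil m n} :
    P.IsMinorGcd m 1 ↔ ∀ e : MvPolynomial (Fin 2) ℂ,
      (∀ c : Fin m ↪o Fin n, e ∣ (P.toMatrix.submatrix id c).det) → IsUnit e := by
  have hr : ∀ r : Fin m ↪o Fin m, ⇑r = id := fun r => by
    have hs : Function.Surjective r := Finite.surjective_of_injective r.injective
    refine r.strictMono.range_inj strictMono_id |>.1 ?_
    rw [hs.range_eq, Set.range_id]
  simp only [IsMinorGcd, minor, hr, one_dvd, implies_true, true_and, ← isUnit_iff_dvd_one]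
  exact ⟨fun h e he => h e fun _ => he, fun h e he => h e (he (RelEmbedding.refl _))⟩

/-- A pencil strictly equivalent to one among whose `m`-minors are `μ ^ m` and `λ ^ m` has
`D_m = 1`. -/
theorem StrictlyEquivalent.isMinorGcd_one {m n : ℕ} {P Q : MatrixPencil m n}
    (h : P.StrictlyEquivalent Q)
    (h0 : ∃ c : Fin m → Fin n, (Q.toMatrix.submatrix id c).det = X 0 ^ m)
    (h1 : ∃ c : Fin m → Fin n, (Q.toMatrix.submatrix id c).det = X 1 ^ m) : P.IsMinorGcd m 1 := by
  rw [isMinorGcd_one_iff]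
  intro e he
  obtain ⟨B, D, hBD⟩ := h.exists_toMatrix_eq
  have key : ∀ c : Fin m → Fin n, e ∣ (Q.toMatrix.submatrix id c).det := by
    intro c
    have : Q.toMatrix.submatrix id c =
        B * (P.toMatrix * D.submatrix id c) := by
      rw [← hBD, ← Matrix.mul_assoc]
      rfl
    rw [this, Matrix.det_mul]
    exact (dvd_det_mul _ he _).mul_left _
  obtain ⟨c0, hc0⟩ := h0
  obtain ⟨c1, hc1⟩ := h1
  have d0 := hc0 ▸ key c0
  have d1 := hc1 ▸ key c1
  have hrel : IsRelPrime (X 0 : MvPolynomial (Fin 2) ℂ) (X 1) :=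
    (X_prime (i := 0)).irreducible.isRelPrime_iff_not_dvd.2 (by simp [X_dvd_X])
  exact (hrel.pow (m := m) (n := m)) d0 d1

/-! ### Two maximal minors of a sum of blocks. -/

theorem LBlock_toMatrix_apply (ε : ℕ) (i : Fin ε) (j : Fin (ε + 1)) :
    (LBlock ε).toMatrix i j =
      (if j = i.succ then X 0 else 0) + (if j = i.castSucc then X 1 else 0) := by
  rw [toMatrix_apply]
  simp only [LBlock, Matrix.of_apply]
  split_ifs <;> simp

/-- Without its first column the block is triangular with `μ` on the diagonal; without its last,
with `λ`. -/
theorem det_LBlock_succ (ε : ℕ) : ((LBlock ε).toMatrix.submatrix id Fin.succ).det = X 0 ^ ε := by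
  rw [Matrix.det_of_isLowerTriangular]
  · simp [LBlock_toMatrix_apply, Fin.ext_iff]
  · intro i j hij
    have : i < j := hij
    simp only [Matrix.submatrix_apply, id, LBlock_toMatrix_apply, Fin.ext_iff, Fin.val_succ,
      Fin.val_castSucc]
    rw [if_neg (by omega), if_neg (by omega), add_zero]

theorem det_LBlock_castSucc (ε : ℕ) :
    ((LBlock ε).toMatrix.submatrix id Fin.castSucc).det = X 1 ^ ε := by
  rw [Matrix.det_of_isUpperTriangular]
  · simp [LBlock_toMatrix_apply, Fin.ext_iff]
  · intro i j hij
    have : j < i := hij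
    simp only [Matrix.submatrix_apply, id, LBlock_toMatrix_apply, Fin.ext_iff, Fin.val_succ,
      Fin.val_castSucc]
    rw [if_neg (by omega), if_neg (by omega), add_zero]

theorem det_blockDiagonal' {R : Type*} [CommRing R] {a : ℕ} {p : Fin a → ℕ}
    (M : ∀ i, Matrix (Fin (p i)) (Fin (p i)) R) :
    (Matrix.blockDiagonal' M).det = ∏ i, (M i).det := by
  rw [(Matrix.blockTriangular_blockDiagonal' M).det_fintype]
  refine Finset.prod_congr rfl fun i _ => ?_
  rw [← Matrix.det_submatrix_equiv_self (Equiv.sigmaSubtype i).symm]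
  congr 1
  ext x y
  exact Matrix.blockDiagonal'_apply_eq M i x y

/-- Maximal minors of a direct sum, taken blockwise. -/
theorem det_directSum {a : ℕ} {p q : Fin a → ℕ} (P : ∀ i, MatrixPencil (p i) (q i))
    (c : ∀ i, Fin (p i) → Fin (q i)) :
    ((directSum P).toMatrix.submatrix id
      (fun x => finSigmaFinEquiv (Sigma.map id c (finSigmaFinEquiv.symm x)))).det =
      ∏ i, ((P i).toMatrix.submatrix id (c i)).det := by
  rw [← det_blockDiagonal', ← Matrix.det_submatrix_equiv_self finSigmaFinEquiv]
  congr 1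
  ext1 ⟨i, x⟩ ⟨j, y⟩
  simp only [Matrix.submatrix_apply, toMatrix_apply, directSum, Matrix.reindex_apply, id,
    Equiv.symm_apply_apply]
  simp only [Sigma.map, id]
  rcases eq_or_ne i j with rfl | hij
  · simp [Matrix.blockDiagonal'_apply_eq, toMatrix_apply]
  · simp [Matrix.blockDiagonal'_apply_ne _ _ _ hij]

theorem cast_rfl {m n : ℕ} (P : MatrixPencil m n) : cast rfl rfl P = P := rfl

theorem EquivalentToLSum.isMinorGcd_one {m n a : ℕ} {P : MatrixPencil m n} {ε : Fin a → ℕ}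
    (h : P.EquivalentToLSum ε) : P.IsMinorGcd m 1 := by
  obtain ⟨rfl, rfl, h⟩ := h
  rw [cast_rfl] at h
  refine h.isMinorGcd_one ⟨_, (det_directSum _ fun i => Fin.succ).trans ?_⟩
    ⟨_, (det_directSum _ fun i => Fin.castSucc).trans ?_⟩
  · simp only [det_LBlock_succ, Finset.prod_pow_eq_pow_sum]
  · simp only [det_LBlock_castSucc, Finset.prod_pow_eq_pow_sum]

/-! ### From `D_m = 1` to block form. -/

/-- If the matrix `t U` is congruent to `x M` modulo `l`, where `t ≠ 0` is constant and `M` is a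
constant singular matrix, then `l` divides `det U`. -/
theorem dvd_det_of_dvd_sub {m : ℕ} {U : Matrix (Fin m) (Fin m) (MvPolynomial (Fin 2) ℂ)}
    {M : Matrix (Fin m) (Fin m) ℂ} (hM : M.det = 0) {t : ℂ} (ht : t ≠ 0)
    {x l : MvPolynomial (Fin 2) ℂ} (h : ∀ i j, l ∣ C t * U i j - x * C (M i j)) : l ∣ U.det := by
  have h1 : (Ideal.Quotient.mk (Ideal.span {l})) ((C t : MvPolynomial (Fin 2) ℂ) • U).det =
      (Ideal.Quotient.mk (Ideal.span {l})) (x • C.mapMatrix M).det := by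
    rw [RingHom.map_det, RingHom.map_det]
    congr 1
    ext i j
    simp only [RingHom.mapMatrix_apply, Matrix.map_apply, Matrix.smul_apply, smul_eq_mul]
    exact Ideal.Quotient.eq.2 (Ideal.mem_span_singleton.2 (h i j))
  rw [Ideal.Quotient.eq, Ideal.mem_span_singleton, Matrix.det_smul, Matrix.det_smul,
    ← RingHom.map_det, hM, map_zero, mul_zero, sub_zero] at h1
  exact (((ht.isUnit.map C).pow _).dvd_mul_left).1 h1

/-- If `D_m = 1`, all nonzero values of the pencil have full row rank. -/
theorem IsMinorGcd.surjective {m n : ℕ} {P : MatrixPencil m n} (h : P.IsMinorGcd m 1) (a b : ℂ)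
    (hab : (a, b) ≠ 0) :
    Function.Surjective (a • Matrix.toLin' P.R + b • Matrix.toLin' P.S) := by
  by_cases hdet : ∃ c : Fin m ↪o Fin n, ((a • P.R + b • P.S).submatrix id c).det ≠ 0
  · obtain ⟨c, hc⟩ := hdet
    intro y
    refine ⟨(1 : Matrix (Fin n) (Fin n) ℂ).submatrix id c *ᵥ
      (((a • P.R + b • P.S).submatrix id c)⁻¹ *ᵥ y), ?_⟩
    have hmul : (a • P.R + b • P.S) * (1 : Matrix (Fin n) (Fin n) ℂ).submatrix id c =
        (a • P.R + b • P.S).submatrix id c := by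
      conv_rhs => rw [← Matrix.mul_one (a • P.R + b • P.S)]
      rfl
    rw [← map_smul, ← map_smul, ← map_add, Matrix.toLin'_apply, Matrix.mulVec_mulVec, hmul,
      Matrix.mulVec_mulVec, Matrix.mul_nonsing_inv _ hc.isUnit, Matrix.one_mulVec]
  · push Not at hdet
    exfalso
    have hl : IsUnit (C a * X 1 - C b * X 0 : MvPolynomial (Fin 2) ℂ) := by
      refine isMinorGcd_one_iff.1 h _ fun c => ?_
      -- Modulo `aλ - bμ`, `a` times the pencil is `μ (aR + bS)` and `b` times it is `λ (aR + bS)`;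
      -- a nonzero one of `a`, `b` is used.
      by_cases ha : a = 0
      · have hb : b ≠ 0 := by
          rintro rfl
          exact hab (by simp [ha])
        refine dvd_det_of_dvd_sub (hdet c) hb (x := X 1) fun i j => ⟨-C (P.R i (c j)), ?_⟩
        simp [toMatrix_apply]
        ring
      · refine dvd_det_of_dvd_sub (hdet c) ha (x := X 0) fun i j => ⟨C (P.S i (c j)), ?_⟩
        simp [toMatrix_apply]
        ring
    -- The form vanishes at `(a, b)`, so it is no unit.
    have := hl.map (MvPolynomial.eval ![a, b])
    simp [mul_comm] at this

/-- Bases as in `NullSpaceBlockBases` bring a pencil to a direct sum of blocks. -/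
theorem equivalentToLSum_of_bases {m n a : ℕ} {P : MatrixPencil m n} {ε : Fin a → ℕ}
    (b : NullSpaceBlockBases (Matrix.toLin' P.R) (Matrix.toLin' P.S) ε) :
    P.EquivalentToLSum ε := by
  have hm : ∑ i, ε i = m := by
    simpa using (Module.finrank_eq_card_basis b.tgt).symm
  have hn : ∑ i, (ε i + 1) = n := by
    simpa using (Module.finrank_eq_card_basis b.src).symm
  refine ⟨hm, hn, ?_⟩
  subst hm hn
  let bV := b.src.reindex finSigmaFinEquiv
  let bW := b.tgt.reindex finSigmaFinEquiv
  let sV := Pi.basisFun ℂ (Fin (∑ i, (ε i + 1)))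
  let sW := Pi.basisFun ℂ (Fin (∑ i, ε i))
  have key : ∀ M : Matrix (Fin (∑ i, ε i)) (Fin (∑ i, (ε i + 1))) ℂ,
      bW.toMatrix sW * M * sV.toMatrix bV = LinearMap.toMatrix bV bW (Matrix.toLin' M) :=
    fun M => by
      have := basis_toMatrix_mul_linearMap_toMatrix_mul_basis_toMatrix bV sV bW sW
        (Matrix.toLin sV sW M)
      rw [LinearMap.toMatrix_toLin] at this
      exact this
  rw [strictlyEquivalent_iff]
  refine ⟨⟨_, _, bW.toMatrix_mul_toMatrix_flip sW, sW.toMatrix_mul_toMatrix_flip bW⟩,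
    ⟨(sV.toMatrix bV).transpose, (bV.toMatrix sV).transpose, ?_, ?_⟩, ?_, ?_⟩
  · rw [← Matrix.transpose_mul, bV.toMatrix_mul_toMatrix_flip sV, Matrix.transpose_one]
  · rw [← Matrix.transpose_mul, sV.toMatrix_mul_toMatrix_flip bV, Matrix.transpose_one]
  · rw [Matrix.transpose_transpose, key]
    ext x y
    obtain ⟨⟨i, x⟩, rfl⟩ := finSigmaFinEquiv.surjective x
    obtain ⟨⟨j, y⟩, rfl⟩ := finSigmaFinEquiv.surjective y
    rw [LinearMap.toMatrix_apply]
    simp only [bV, bW, Module.Basis.reindex_apply, Module.Basis.repr_reindex_apply,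
      Equiv.symm_apply_apply, cast, directSum, Matrix.reindex_apply, finCongr_refl,
      Equiv.refl_symm, Equiv.coe_refl, Matrix.submatrix_apply, id]
    refine Fin.cases ?_ (fun y => ?_) y
    · rw [b.fst_zero, map_zero, Finsupp.zero_apply]
      rcases eq_or_ne i j with rfl | hij
      · simp [Matrix.blockDiagonal'_apply_eq, LBlock, (Fin.succ_ne_zero _).symm]
      · rw [Matrix.blockDiagonal'_apply_ne _ _ _ hij]
    · rw [b.fst_succ, Module.Basis.repr_self]
      rcases eq_or_ne i j with rfl | hij
      · simp [Matrix.blockDiagonal'_apply_eq, LBlock, Finsupp.single_apply]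
      · rw [Matrix.blockDiagonal'_apply_ne _ _ _ hij, Finsupp.single_eq_of_ne]
        exact fun h => hij (congrArg Sigma.fst h)
  · rw [Matrix.transpose_transpose, key]
    ext x y
    obtain ⟨⟨i, x⟩, rfl⟩ := finSigmaFinEquiv.surjective x
    obtain ⟨⟨j, y⟩, rfl⟩ := finSigmaFinEquiv.surjective y
    rw [LinearMap.toMatrix_apply]
    simp only [bV, bW, Module.Basis.reindex_apply, Module.Basis.repr_reindex_apply,
      Equiv.symm_apply_apply, cast, directSum, Matrix.reindex_apply, finCongr_refl,
      Equiv.refl_symm, Equiv.coe_refl, Matrix.submatrix_apply, id]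
    refine Fin.lastCases ?_ (fun y => ?_) y
    · rw [b.snd_last, map_zero, Finsupp.zero_apply]
      rcases eq_or_ne i j with rfl | hij
      · simp [Matrix.blockDiagonal'_apply_eq, LBlock, (Fin.castSucc_ne_last _).symm]
      · rw [Matrix.blockDiagonal'_apply_ne _ _ _ hij]
    · rw [b.snd_castSucc, Module.Basis.repr_self]
      rcases eq_or_ne i j with rfl | hij
      · simp [Matrix.blockDiagonal'_apply_eq, LBlock, Finsupp.single_apply]
      · rw [Matrix.blockDiagonal'_apply_ne _ _ _ hij, Finsupp.single_eq_of_ne]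
        exact fun h => hij (congrArg Sigma.fst h)

theorem IsMinorGcd.exists_equivalentToLSum {m n : ℕ} {P : MatrixPencil m n}
    (h : P.IsMinorGcd m 1) : ∃ (a : ℕ) (ε : Fin a → ℕ), P.EquivalentToLSum ε := by
  obtain ⟨ι, _, ε, ⟨b⟩⟩ := NullSpaceBlockBases.exists_of_surjective _ _ h.surjective
  exact ⟨_, _, equivalentToLSum_of_bases (b.reindex (Fintype.equivFin ι).symm)⟩

/-- A block `L_0` is a zero column; the column transformation turns its unit vector into a nonzero
constant null vector of `P`. -/
theorem EquivalentToLSum.one_le {m n a : ℕ} {P : MatrixPencil m n} {ε : Fin a → ℕ}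
    (h : P.EquivalentToLSum ε) (hP : P.NoConstantRightNullVector) (i : Fin a) : 1 ≤ ε i := by
  obtain ⟨rfl, rfl, h⟩ := h
  rw [strictlyEquivalent_iff] at h
  obtain ⟨B, D, h1, h2⟩ := h
  by_contra hi
  have hi : ε i = 0 := by omega
  let k := finSigmaFinEquiv (n := fun i => ε i + 1) ⟨i, 0⟩
  have hB : ∀ M : Matrix (Fin (∑ i, ε i)) (Fin (∑ i, (ε i + 1))) ℂ,
      (∀ x, (B.val * M * D.val.transpose) x k = 0) →
        M *ᵥ (D.val.transpose *ᵥ Pi.single k 1) = 0 := by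
    intro M hM
    have : B.val *ᵥ (M *ᵥ (D.val.transpose *ᵥ Pi.single k 1)) = 0 := by
      rw [Matrix.mulVec_mulVec, Matrix.mulVec_mulVec, Matrix.mulVec_single_one]
      exact funext hM
    exact Matrix.mulVec_injective_of_isUnit B.isUnit (this.trans (Matrix.mulVec_zero _).symm)
  have hblock : ∀ (M : ∀ i, Matrix (Fin (ε i)) (Fin (ε i + 1)) ℂ) (x : Fin (∑ i, ε i)),
      Matrix.blockDiagonal' M (finSigmaFinEquiv.symm x) (finSigmaFinEquiv.symm k) = 0 := by
    intro M x
    rw [Equiv.symm_apply_apply]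
    obtain ⟨j, x⟩ := finSigmaFinEquiv.symm x
    refine Matrix.blockDiagonal'_apply_ne _ _ _ ?_
    rintro rfl
    exact (Fin.cast hi x).elim0
  have hv := hP (D.val.transpose *ᵥ Pi.single k 1)
    (hB _ fun x => by rw [h1]; exact hblock (fun j => (LBlock (ε j)).R) x)
    (hB _ fun x => by rw [h2]; exact hblock (fun j => (LBlock (ε j)).S) x)
  have hD : IsUnit D.val.transpose := (Matrix.isUnit_transpose _).2 D.isUnit
  have := congrFun (Matrix.mulVec_injective_of_isUnit hD (hv.trans (Matrix.mulVec_zero _).symm)) k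
  simp at this

theorem directSum_LBlock_one {m : ℕ} (ε : Fin 1 → ℕ) (hm : ∑ i, ε i = m)
    (hn : ∑ i, (ε i + 1) = m + 1) : cast hm hn (directSum fun i => LBlock (ε i)) = LBlock m := by
  obtain rfl : ε 0 = m := by simpa using hm
  have e : ∀ {n : Fin 1 → ℕ} {k : ℕ} (h : ∑ i, n i = k) (h0 : n 0 = k) (x : Fin k),
      finSigmaFinEquiv.symm ((finCongr h).symm x) = ⟨0, Fin.cast h0.symm x⟩ := by
    intro n k h h0 x
    rw [Equiv.symm_apply_eq]
    ext
    rw [finSigmaFinEquiv_one]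
    rfl
  ext i j <;>
  · simp only [cast, directSum, Matrix.reindex_apply, Matrix.submatrix_apply]
    rw [e hm rfl, e hn rfl, Matrix.blockDiagonal'_apply_eq]
    rfl

end MatrixPencil

theorem mainTheorem7 :
    (∀ (m n : ℕ), m < n → ∀ P : MatrixPencil m n,
      (P.IsMinorGcd m 1 ↔ ∃ (a : ℕ) (ε : Fin a → ℕ), P.EquivalentToLSum ε) ∧
      (P.NoConstantRightNullVector →
        (P.IsMinorGcd m 1 ↔
          ∃ (a : ℕ) (ε : Fin a → ℕ), (∀ i, 1 ≤ ε i) ∧ P.EquivalentToLSum ε))) ∧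
    (∀ (m : ℕ) (P : MatrixPencil m (m + 1)),
      P.IsMinorGcd m 1 ↔ P.StrictlyEquivalent (MatrixPencil.LBlock m)) := by
  refine ⟨fun m n _ P => ⟨⟨fun h => h.exists_equivalentToLSum, ?_⟩, fun hP => ⟨fun h => ?_, ?_⟩⟩,
    fun m P => ⟨fun h => ?_, fun h => ?_⟩⟩
  · rintro ⟨a, ε, h⟩
    exact h.isMinorGcd_one
  · obtain ⟨a, ε, hε⟩ := h.exists_equivalentToLSum
    exact ⟨a, ε, hε.one_le hP, hε⟩
  · rintro ⟨a, ε, -, h⟩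
    exact h.isMinorGcd_one
  · obtain ⟨a, ε, hm, hn, h⟩ := h.exists_equivalentToLSum
    -- Each block has one more column than rows, so the number of blocks is `n - m`.
    obtain rfl : a = 1 := by
      rw [Finset.sum_add_distrib, hm] at hn
      simpa using hn
    rwa [MatrixPencil.directSum_LBlock_one] at h
  · exact h.isMinorGcd_one ⟨_, MatrixPencil.det_LBlock_succ m⟩
      ⟨_, MatrixPencil.det_LBlock_castSucc m⟩
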